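/- Let $V$ and $U$ be Banach spaces, let $T\ge 0$, let $(\Omega,\mathcal F,\mathbb P)$ be a probability space, and let $X:[0,T]\times\Omega\to V$ be a c\`adl\`ag stochastic process. Let $p\ge 1$, and assume that for almost every $\omega$ the path $X(\omega)$ has finite $p$-variation, that is, \[ \sup_{\Pi}\sum_{[u,v]\in\Pi}\|X_v(\omega)-X_u(\omega)\|^p<\infty , \] where the supremum is over all finite partitions $\Pi$ of $[0,T]$. Let $F:V\to U$ be $\lfloor p\rfloor+1$ times continuously differentiable, with $D^jF$ bounded on $V$ for $j=0,\dots,\lfloor p\rfloor+1$. For a path $x:[0,T]\to V$ let $\mathbf{x}$ denote the reduced rough path over $x$, with levels $\mathbf{x}^k_{s,t}=\frac1{k!}(x_t-x_s)^{\otimes k}$ for $1\le k\le\lfloor p\rfloor$. The reduced rough integral of $DF(x)$ is \[ \int_0^T DF(x_t)\,d\mathbf{x}_t:=\operatorname{RRS-}\lim_{\Pi}\ \sum_{[u,v]\in\Pi}\ \sum_{k=1}^{\lfloor p\rfloor}D^kF(x_u)\,\mathbf{x}^k_{u,v} =\operatorname{RRS-}\lim_{\Pi}\ \sum_{[u,v]\in\Pi}\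 \sum_{k=1}^{\lfloor p\rfloor}\frac1{k!}D^kF(x_u)(x_v-x_u)^{\otimes k}, \] where $S_\Pi$ converges to $K$ in the refinement Riemann--Stieltjes (RRS) sense if for every $\varepsilon>0$ there is a partition $\Pi_\varepsilon$ of $[0,T]$ such that $\|S_\Pi-K\|<\varepsilon$ for every partition $\Pi\supset\Pi_\varepsilon$ of $[0,T]$. Then, for almost every $\omega\in\Omega$, the reduced rough integral of $DF(X(\omega))$ exists, the series below converges absolutely, and \[ F(X_T)-F(X_0)=\int_0^T DF(X_t)\,d\mathbf{X}_t+\sum_{0<t\le T}\Big(F(X_t)-F(X_{t-})-\sum_{k=1}^{\lfloor p\rfloor}\frac1{k!}D^kF(X_{t-})(\Delta_t^-X)^{\otimes k}\Big), \] where $X_{t-}=\lim_{u\uparrow t}X_u$ and $\Delta_t^-X=X_t-X_{t-}$. -/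

import Mathlib

open Set Filter Topology MeasureTheory
open scoped ENNReal

/-- A finite partition of `[0, T]`, given by its set of division points: a finite subset of
`[0, T]` that contains both end points. -/
def IsPartition (T : ℝ) (P : Finset ℝ) : Prop :=
  (0 : ℝ) ∈ P ∧ T ∈ P ∧ ∀ t ∈ P, t ∈ Icc (0 : ℝ) T

open Classical in
/-- The intervals `[u, v]` of a partition: the pairs of consecutive division points. -/
noncomputable def partitionIntervals (P : Finset ℝ) : Finset (ℝ × ℝ) :=
  (P ×ˢ P).filter fun q => q.1 < q.2 ∧ ∀ w ∈ P, w ≤ q.1 ∨ q.2 ≤ w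

/-- The `p`-variation over `[0, T]` of a path `x` (only the values of `x` on `[0, T]` matter),
`(sup_P ∑_{[u, v] ∈ P} ‖x v - x u‖ ^ p) ^ (1 / p)`, as an extended nonnegative real. -/
noncomputable def pVariation {V : Type*} [NormedAddCommGroup V] (p T : ℝ) (x : ℝ → V) : ℝ≥0∞ :=
  (⨆ (P : Finset ℝ) (_ : IsPartition T P),
    ∑ q ∈ partitionIntervals P, ‖x q.2 - x q.1‖ₑ ^ p) ^ (1 / p)

/-- `x` is càdlàg on `[0, T]`: right-continuous on `[0, T)`, with left limits on `(0, T]`. -/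
def IsCadlagOn {V : Type*} [TopologicalSpace V] (T : ℝ) (x : ℝ → V) : Prop :=
  (∀ t ∈ Ico (0 : ℝ) T, Tendsto x (𝓝[>] t) (𝓝 (x t))) ∧
    ∀ t ∈ Ioc (0 : ℝ) T, ∃ l : V, Tendsto x (𝓝[<] t) (𝓝 l)

/-- `F` belongs to `C_b^m`: it is `m` times continuously differentiable, and `F` and its
differentials up to order `m` are bounded. -/
def IsCb {V U : Type*} [NormedAddCommGroup V] [NormedSpace ℝ V] [NormedAddCommGroup U]
    [NormedSpace ℝ U] (m : ℕ) (F : V → U) : Prop :=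
  ContDiff ℝ m F ∧ ∀ j ≤ m, ∃ C : ℝ, ∀ v : V, ‖iteratedFDeriv ℝ j F v‖ ≤ C

/-- The Riemann sums `∑_{[u, v] ∈ P} Ξ u v` converge to `K` in the refinement
Riemann-Stieltjes (RRS) sense. -/
def HasRRSLimit {U : Type*} [NormedAddCommGroup U] (T : ℝ) (Ξ : ℝ → ℝ → U) (K : U) : Prop :=
  ∀ ε > 0, ∃ P₀ : Finset ℝ, IsPartition T P₀ ∧
    ∀ P : Finset ℝ, IsPartition T P → P₀ ⊆ P →
      ‖∑ q ∈ partitionIntervals P, Ξ q.1 q.2 - K‖ < ε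

/-- RRS limits are unique. -/
theorem HasRRSLimit.unique {U : Type*} [NormedAddCommGroup U] {T : ℝ} {Ξ : ℝ → ℝ → U}
    {K L : U} (hK : HasRRSLimit T Ξ K) (hL : HasRRSLimit T Ξ L) : K = L := by
  classical
  by_contra hne
  have hpos : 0 < ‖K - L‖ / 2 := half_pos (norm_pos_iff.mpr (sub_ne_zero.mpr hne))
  obtain ⟨P, hP, hP'⟩ := hK _ hpos
  obtain ⟨Q, hQ, hQ'⟩ := hL _ hpos
  have hPQ : IsPartition T (P ∪ Q) := by
    refine ⟨Finset.mem_union_left _ hP.1, Finset.mem_union_left _ hP.2.1, fun t ht => ?_⟩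
    rcases Finset.mem_union.mp ht with h | h
    · exact hP.2.2 t h
    · exact hQ.2.2 t h
  have h1 := hP' _ hPQ Finset.subset_union_left
  have h2 := hQ' _ hPQ Finset.subset_union_right
  have h3 := norm_sub_le_norm_sub_add_norm_sub K
    (∑ q ∈ partitionIntervals (P ∪ Q), Ξ q.1 q.2) L
  rw [norm_sub_rev K (∑ q ∈ partitionIntervals (P ∪ Q), Ξ q.1 q.2)] at h3
  linarith

/-- The levels `𝕏^k_{s,t} = (1 / k!) (x_t - x_s)^{⊗ k}` of the reduced rough path over `x`. -/
noncomputable def reducedLift {V : Type*} [NormedAddCommGroup V] [NormedSpace ℝ V]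
    (x : ℝ → V) (k : ℕ) (s t : ℝ) : PiTensorProduct ℝ (fun _ : Fin k => V) :=
  (1 / (k.factorial : ℝ)) • PiTensorProduct.tprod ℝ (fun _ : Fin k => x t - x s)

/-- `DF(x) = (DF(x), D²F(x), …)` as a path controlled by `x`: its component of index `k` at time
`s` is the differential `D^{k+1}F(x_s)`, regarded as a linear map on `V^{⊗ (k+1)}`
(an element of `L(V^{⊗ k}, L(V, U))`). -/
noncomputable def gradientPath {V U : Type*} [NormedAddCommGroup V] [NormedSpace ℝ V]
    [NormedAddCommGroup U] [NormedSpace ℝ U] (F : V → U) (x : ℝ → V) (k : ℕ) (s : ℝ) :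
    PiTensorProduct ℝ (fun _ : Fin (k + 1) => V) →ₗ[ℝ] U :=
  PiTensorProduct.lift (iteratedFDeriv ℝ (k + 1) F (x s)).toMultilinearMap

/-- `I` is the reduced rough integral over `[0, T]` of `Y` against `𝕏`, in `n` levels: the RRS
limit of the compensated Riemann sums `∑_{[u, v] ∈ P} ∑_{k < n} Y^k_u 𝕏^{k+1}_{u,v}`. -/
def HasReducedRoughIntegral {V U : Type*} [NormedAddCommGroup V] [NormedSpace ℝ V]
    [NormedAddCommGroup U] [NormedSpace ℝ U] (n : ℕ) (T : ℝ)
    (Y : (k : ℕ) → ℝ → PiTensorProduct ℝ (fun _ : Fin (k + 1) => V) →ₗ[ℝ] U)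
    (𝕏 : (k : ℕ) → ℝ → ℝ → PiTensorProduct ℝ (fun _ : Fin k => V)) (I : U) : Prop :=
  HasRRSLimit T (fun u v => ∑ k ∈ Finset.range n, Y k u (𝕏 (k + 1) u v)) I

/-- The left-jump correction
`F(x_t) - F(x_{t-}) - ∑_{k=1}^{n} (1 / k!) D^kF(x_{t-}) (x_t - x_{t-})^{⊗ k}`. -/
noncomputable def leftJumpCorrection {V U : Type*} [NormedAddCommGroup V] [NormedSpace ℝ V]
    [NormedAddCommGroup U] [NormedSpace ℝ U] (n : ℕ) (F : V → U) (x : ℝ → V) (t : ℝ) : U :=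
  F (x t) - F (Function.leftLim x t) -
    ∑ k ∈ Finset.Icc 1 n, (1 / (k.factorial : ℝ)) •
      iteratedFDeriv ℝ k F (Function.leftLim x t) (fun _ => x t - Function.leftLim x t)

/-! ### Combinatorics of consecutive division points. -/

section Partitions

/-! With `n = ⌊p⌋`, each compensated summand is `F(x_v) - F(x_u) - R(x_u, x_v)`, where `R` is the
Taylor remainder of order `n`. The increments of `F` telescope, so everything reduces to the limit
of `∑ R(x_u, x_v)`; no sewing argument is needed.

Since `‖R(a, b)‖ ≤ C ‖b - a‖ ^ (n + 1)` and `n + 1 > p`, intervals with increments at most `δ`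
contribute at most `C δ ^ (n + 1 - p) W`, with `W` a bound for the `p`-th power sums. For a càdlàg
path the other intervals end in a finite set of times `t`; refinement moves their left ends up to
`t`, and continuity of `R` in its first argument gives `R(x_{t-}, x_t)`. Hence the limit is the jump
sum (`hasRRSLimit_tsum_leftLim`), which converges absolutely by `summable_norm_leftLim`. Probability
enters only through the null sets. -/

theorem mem_partitionIntervals {P : Finset ℝ} {q : ℝ × ℝ} :
    q ∈ partitionIntervals P ↔
      (q.1 ∈ P ∧ q.2 ∈ P) ∧ q.1 < q.2 ∧ ∀ w ∈ P, w ≤ q.1 ∨ q.2 ≤ w := by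
  simp [partitionIntervals]

/-- Summing over the intervals of `P` whose right end point lies in `S` is summing over `S`, if
every point of `S` is a division point other than the first one. -/
theorem sum_partitionIntervals_right {M : Type*} [AddCommMonoid M] {P S : Finset ℝ} (hSP : S ⊆ P)
    (hlt : ∀ t ∈ S, ∃ s ∈ P, s < t) (f : ℝ → M) :
    ∑ q ∈ partitionIntervals P with q.2 ∈ S, f q.2 = ∑ t ∈ S, f t := by
  refine Finset.sum_nbij (fun q => q.2) (fun q hq => (Finset.mem_filter.1 hq).2) ?_ ?_
    (fun _ _ => rfl)
  · rintro ⟨u, v⟩ hq ⟨u', v'⟩ hq' (rfl : v = v')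
    have h := mem_partitionIntervals.1 (Finset.mem_filter.1 hq).1
    have h' := mem_partitionIntervals.1 (Finset.mem_filter.1 hq').1
    have h1 := h.2.2 u' h'.1.1
    have h2 := h'.2.2 u h.1.1
    have h3 := h.2.1
    have h4 := h'.2.1
    simp only at h1 h2 h3 h4
    have : u = u' := by grind
    rw [this]
  · intro t ht
    have hne : (P.filter (· < t)).Nonempty := by
      obtain ⟨s, hs, hst⟩ := hlt t ht
      exact ⟨s, Finset.mem_filter.2 ⟨hs, hst⟩⟩
    have hmem := Finset.mem_filter.1 ((P.filter (· < t)).max'_mem hne)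
    refine ⟨((P.filter (· < t)).max' hne, t), ?_, rfl⟩
    refine Finset.mem_coe.2 (Finset.mem_filter.2 ⟨mem_partitionIntervals.2
      ⟨⟨hmem.1, hSP ht⟩, hmem.2, fun w hw => ?_⟩, ht⟩)
    rcases lt_or_ge w t with h | h
    · exact Or.inl (Finset.le_max' _ _ (Finset.mem_filter.2 ⟨hw, h⟩))
    · exact Or.inr h

/-- Summing over the intervals of `P` whose left end point lies in `S` is summing over `S`, if
every point of `S` is a division point other than the last one. -/
theorem sum_partitionIntervals_left {M : Type*} [AddCommMonoid M] {P S : Finset ℝ} (hSP : S ⊆ P)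
    (hlt : ∀ t ∈ S, ∃ s ∈ P, t < s) (f : ℝ → M) :
    ∑ q ∈ partitionIntervals P with q.1 ∈ S, f q.1 = ∑ t ∈ S, f t := by
  refine Finset.sum_nbij (fun q => q.1) (fun q hq => (Finset.mem_filter.1 hq).2) ?_ ?_
    (fun _ _ => rfl)
  · rintro ⟨u, v⟩ hq ⟨u', v'⟩ hq' (rfl : u = u')
    have h := mem_partitionIntervals.1 (Finset.mem_filter.1 hq).1
    have h' := mem_partitionIntervals.1 (Finset.mem_filter.1 hq').1
    have h1 := h.2.2 v' h'.1.2
    have h2 := h'.2.2 v h.1.2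
    have h3 := h.2.1
    have h4 := h'.2.1
    simp only at h1 h2 h3 h4
    have : v = v' := by grind
    rw [this]
  · intro t ht
    have hne : (P.filter (t < ·)).Nonempty := by
      obtain ⟨s, hs, hst⟩ := hlt t ht
      exact ⟨s, Finset.mem_filter.2 ⟨hs, hst⟩⟩
    have hmem := Finset.mem_filter.1 ((P.filter (t < ·)).min'_mem hne)
    refine ⟨(t, (P.filter (t < ·)).min' hne), ?_, rfl⟩
    refine Finset.mem_coe.2 (Finset.mem_filter.2 ⟨mem_partitionIntervals.2
      ⟨⟨hSP ht, hmem.1⟩, hmem.2, fun w hw => ?_⟩, ht⟩)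
    rcases lt_or_ge t w with h | h
    · exact Or.inr (Finset.min'_le _ _ (Finset.mem_filter.2 ⟨hw, h⟩))
    · exact Or.inl h

/-- Right end points run once through `P \ {0}` and left end points once through `P \ {T}`, so no
ordering of `P` or induction is needed. -/
theorem IsPartition.sum_sub {M : Type*} [AddCommGroup M] {T : ℝ} {P : Finset ℝ}
    (hP : IsPartition T P) (f : ℝ → M) :
    ∑ q ∈ partitionIntervals P, (f q.2 - f q.1) = f T - f 0 := by
  have hr := sum_partitionIntervals_right (P.erase_subset 0)
    (fun t ht => ⟨0, hP.1, lt_of_le_of_ne (hP.2.2 t (Finset.mem_of_mem_erase ht)).1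
      (Finset.ne_of_mem_erase ht).symm⟩) f
  have hl := sum_partitionIntervals_left (P.erase_subset T)
    (fun t ht => ⟨T, hP.2.1, lt_of_le_of_ne (hP.2.2 t (Finset.mem_of_mem_erase ht)).2
      (Finset.ne_of_mem_erase ht)⟩) f
  rw [Finset.filter_true_of_mem] at hr hl
  · rw [Finset.sum_sub_distrib, hr, hl, Finset.sum_erase_eq_sub hP.1,
      Finset.sum_erase_eq_sub hP.2.1]
    abel
  · intro q hq
    obtain ⟨⟨h1, h2⟩, h3, -⟩ := mem_partitionIntervals.1 hq
    exact Finset.mem_erase.2 ⟨(h3.trans_le (hP.2.2 _ h2).2).ne, h1⟩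
  · intro q hq
    obtain ⟨⟨h1, h2⟩, h3, -⟩ := mem_partitionIntervals.1 hq
    exact Finset.mem_erase.2 ⟨((hP.2.2 _ h1).1.trans_lt h3).ne', h2⟩

/-- A property holding near each point of a finite set `S` on its left holds for all intervals
that end in `S`, in all sufficiently fine partitions. -/
theorem exists_isPartition_forall_left {T : ℝ} (hT : 0 ≤ T) {S : Finset ℝ}
    (hS : ∀ t ∈ S, t ∈ Ioc 0 T) {φ : ℝ → ℝ → Prop} (hφ : ∀ t ∈ S, ∀ᶠ u in 𝓝[<] t, φ t u) :
    ∃ P₀, IsPartition T P₀ ∧ S ⊆ P₀ ∧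
      ∀ P, P₀ ⊆ P → ∀ q ∈ partitionIntervals P, q.2 ∈ S → φ q.2 q.1 := by
  classical
  have key : ∀ t ∈ S, ∃ s ∈ Ico 0 t, ∀ u ∈ Ico s t, φ t u := by
    intro t ht
    have h0 : (0 : ℝ) < t := (hS t ht).1
    obtain ⟨l, hl, hlt⟩ := (mem_nhdsLT_iff_exists_Ioo_subset' h0).1 (hφ t ht)
    -- `φ` is known only on the open interval `(l, t)`; the midpoint gives a division point that may
    -- itself serve as `u`.
    refine ⟨(max 0 l + t) / 2, ⟨?_, ?_⟩, fun u hu => hlt ⟨?_, hu.2⟩⟩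
    · have := le_max_left 0 l
      linarith
    · have := max_lt h0 hl
      linarith
    · have := max_lt h0 hl
      have := le_max_right 0 l
      linarith [hu.1]
  choose! s hs hsφ using key
  refine ⟨insert 0 (insert T (S ∪ S.image s)), ⟨by simp, by simp, ?_⟩, ?_, ?_⟩
  · intro t ht
    simp only [Finset.mem_insert, Finset.mem_union, Finset.mem_image] at ht
    rcases ht with rfl | rfl | ht | ⟨r, hr, rfl⟩
    · exact ⟨le_rfl, hT⟩
    · exact ⟨hT, le_rfl⟩
    · exact Ioc_subset_Icc_self (hS t ht)
    · exact ⟨(hs r hr).1, (hs r hr).2.le.trans (hS r hr).2⟩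
  · intro t ht
    simp [ht]
  · intro P hP q hq hqS
    obtain ⟨-, hlt, hcons⟩ := mem_partitionIntervals.1 hq
    have hmem : s q.2 ∈ P := hP (by
      simp only [Finset.mem_insert, Finset.mem_union, Finset.mem_image]
      exact Or.inr (Or.inr (Or.inr ⟨_, hqS, rfl⟩)))
    refine hsφ _ hqS _ ⟨?_, hlt⟩
    exact (hcons _ hmem).resolve_right (not_le.2 (hs _ hqS).2)

end Partitions

/-! ### Càdlàg paths, `p`-variation and sums over jumps. -/

section Paths

variable {V : Type*} [NormedAddCommGroup V] {T : ℝ} {x : ℝ → V}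

theorem IsCadlagOn.tendsto_leftLim (hx : IsCadlagOn T x) {t : ℝ} (ht : t ∈ Ioc 0 T) :
    Tendsto x (𝓝[<] t) (𝓝 (Function.leftLim x t)) :=
  tendsto_leftLim_of_tendsto (hx.2 t ht)

/-- A càdlàg path oscillates by at most `δ` on intervals that contain none of finitely many
points. -/
theorem IsCadlagOn.exists_finset_norm_sub_le (hx : IsCadlagOn T x) {δ : ℝ} (hδ : 0 < δ) :
    ∃ Q : Finset ℝ, ∀ u ∈ Icc 0 T, ∀ v ∈ Icc 0 T, u ≤ v → (∀ w ∈ Q, w ∉ Ioc u v) →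
      ‖x v - x u‖ ≤ δ := by
  classical
  -- Only `u` is localized, while `v` ranges over all of `[0, T]`; this makes the property stable
  -- under unions.
  refine (isCompact_Icc (a := (0 : ℝ)) (b := T)).induction_on
    (p := fun s => ∃ Q : Finset ℝ, ∀ u ∈ s, ∀ v ∈ Icc 0 T, u ≤ v → (∀ w ∈ Q, w ∉ Ioc u v) →
      ‖x v - x u‖ ≤ δ) ⟨∅, by simp⟩ ?_ ?_ ?_
  · rintro s t hst ⟨Q, hQ⟩
    exact ⟨Q, fun u hu => hQ u (hst hu)⟩
  · rintro s t ⟨Q, hQ⟩ ⟨Q', hQ'⟩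
    refine ⟨Q ∪ Q', fun u hu v hv huv hw => ?_⟩
    rcases hu with hu | hu
    · exact hQ u hu v hv huv fun w hwQ => hw w (Finset.mem_union_left _ hwQ)
    · exact hQ' u hu v hv huv fun w hwQ => hw w (Finset.mem_union_right _ hwQ)
  · intro t ht
    have hclose : ∀ {c a b : V}, a ∈ Metric.ball c (δ / 2) → b ∈ Metric.ball c (δ / 2) →
        ‖b - a‖ ≤ δ := by
      intro c a b ha hb
      rw [← dist_eq_norm]
      have := dist_triangle_right b a c
      rw [Metric.mem_ball] at ha hb
      linarith
    have hleft : ∃ l < t, ∀ u ∈ Ioo l t, ∀ v ∈ Ioo l t, u ∈ Icc 0 T → ‖x v - x u‖ ≤ δ := by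
      rcases ht.1.eq_or_lt with h0 | h0
      · exact ⟨t - 1, by linarith, fun u hu v hv hu' => by linarith [hu.2, hu'.1]⟩
      · obtain ⟨c, hc⟩ := hx.2 t ⟨h0, ht.2⟩
        obtain ⟨l, hl, hlt⟩ := (mem_nhdsLT_iff_exists_Ioo_subset' h0).1
          (hc (Metric.ball_mem_nhds c (half_pos hδ)))
        exact ⟨l, hl, fun u hu v hv _ => hclose (hlt hu) (hlt hv)⟩
    have hright : ∃ r > t, ∀ u ∈ Ico t r, ∀ v ∈ Ico t r, u ≤ v → v ∈ Icc 0 T →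
        ‖x v - x u‖ ≤ δ := by
      rcases ht.2.eq_or_lt with h0 | h0
      · refine ⟨t + 1, by linarith, fun u hu v hv huv hv' => ?_⟩
        have h1 : v = t := le_antisymm (h0 ▸ hv'.2) hv.1
        have h2 : u = t := le_antisymm (h1 ▸ huv) hu.1
        simp [h1, h2, hδ.le]
      · obtain ⟨r, hr, hrt⟩ := (mem_nhdsGT_iff_exists_Ioo_subset' h0).1
          (hx.1 t ⟨ht.1, h0⟩ (Metric.ball_mem_nhds (x t) (half_pos hδ)))
        have hmem : ∀ u ∈ Ico t r, x u ∈ Metric.ball (x t) (δ / 2) := by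
          intro u hu
          rcases hu.1.eq_or_lt with rfl | h
          · exact Metric.mem_ball_self (half_pos hδ)
          · exact hrt ⟨h, hu.2⟩
        exact ⟨r, hr, fun u hu v hv _ _ => hclose (hmem u hu) (hmem v hv)⟩
    obtain ⟨l, hl, hleft⟩ := hleft
    obtain ⟨r, hr, hright⟩ := hright
    -- The point `t` separates the two sides, and `r` keeps `v` from leaving the neighbourhood.
    refine ⟨Icc 0 T ∩ Ioo l r, Filter.inter_mem self_mem_nhdsWithin
      (mem_nhdsWithin_of_mem_nhds (Ioo_mem_nhds hl hr)), {t, r}, ?_⟩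
    rintro u ⟨hu, hul, hur⟩ v hv huv hw
    have hvr : v < r := by
      by_contra! h
      exact hw r (by simp) ⟨hur, h⟩
    rcases lt_or_ge u t with h | h
    · have hvt : v < t := by
        by_contra! h'
        exact hw t (by simp) ⟨h, h'⟩
      exact hleft u ⟨hul, h⟩ v ⟨hul.trans_le huv, hvt⟩ hu
    · exact hright u ⟨h, hur⟩ v ⟨h.trans huv, hvr⟩ huv hv

/-- Finiteness is unaffected by the outer power `1 / p`, so the supremum itself serves as a real
bound. -/
theorem exists_sum_rpow_le_of_pVariation_lt_top {p : ℝ} (hp : 1 ≤ p)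
    (hx : pVariation p T x < ∞) :
    ∃ W : ℝ, 0 ≤ W ∧ ∀ P, IsPartition T P →
      ∑ q ∈ partitionIntervals P, ‖x q.2 - x q.1‖ ^ p ≤ W := by
  have hp0 : 0 < p := by linarith
  rw [pVariation, ENNReal.rpow_lt_top_iff_of_pos (by positivity)] at hx
  refine ⟨(⨆ (P : Finset ℝ) (_ : IsPartition T P),
    ∑ q ∈ partitionIntervals P, ‖x q.2 - x q.1‖ₑ ^ p).toReal, ENNReal.toReal_nonneg,
    fun P hP => ?_⟩
  have h := le_iSup₂ (f := fun (P : Finset ℝ) (_ : IsPartition T P) =>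
    ∑ q ∈ partitionIntervals P, ‖x q.2 - x q.1‖ₑ ^ p) P hP
  have h' := ENNReal.toReal_mono hx.ne h
  rw [ENNReal.toReal_sum (fun q _ => by
    exact (ENNReal.rpow_lt_top_of_nonneg hp0.le enorm_ne_top).ne)] at h'
  simpa [← ENNReal.toReal_rpow] using h'

/-- A path with bounded `p`-th power sums over partitions has bounded increments. -/
theorem norm_sub_le_of_sum_rpow_le {p W : ℝ} (hp : 0 < p)
    (hW : ∀ P, IsPartition T P → ∑ q ∈ partitionIntervals P, ‖x q.2 - x q.1‖ ^ p ≤ W)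
    {u v : ℝ} (hu : u ∈ Icc 0 T) (hv : v ∈ Icc 0 T) (huv : u < v) :
    ‖x v - x u‖ ≤ W ^ p⁻¹ := by
  classical
  have hP : IsPartition T {0, u, v, T} := by
    refine ⟨by simp, by simp, fun t ht => ?_⟩
    simp only [Finset.mem_insert, Finset.mem_singleton] at ht
    rcases ht with rfl | rfl | rfl | rfl
    · exact ⟨le_rfl, hu.1.trans hu.2⟩
    · exact hu
    · exact hv
    · exact ⟨hu.1.trans hu.2, le_rfl⟩
  have hmem : (u, v) ∈ partitionIntervals {0, u, v, T} := by
    refine mem_partitionIntervals.2 ⟨by simp, huv, fun w hw => ?_⟩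
    simp only [Finset.mem_insert, Finset.mem_singleton] at hw
    rcases hw with rfl | rfl | rfl | rfl
    · exact Or.inl hu.1
    · exact Or.inl le_rfl
    · exact Or.inr le_rfl
    · exact Or.inr hv.2
  have h := (Finset.single_le_sum (f := fun q : ℝ × ℝ => ‖x q.2 - x q.1‖ ^ p)
    (fun q _ => by positivity) hmem).trans (hW _ hP)
  rw [Real.le_rpow_inv_iff_of_pos (norm_nonneg _) (le_trans (by positivity) h) hp]
  exact h

variable {U : Type*} [NormedAddCommGroup U]

/-- Sums of a two-parameter function of order `m > p` over intervals with increments at most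
`δ`. -/
theorem sum_norm_le_of_norm_sub_le {p W C δ m : ℝ} (hpm : p < m) (hC : 0 ≤ C)
    {R : V → V → U} (hR : ∀ a b, ‖R a b‖ ≤ C * ‖b - a‖ ^ m)
    (hW : ∀ P, IsPartition T P → ∑ q ∈ partitionIntervals P, ‖x q.2 - x q.1‖ ^ p ≤ W)
    {P : Finset ℝ} (hP : IsPartition T P) (hδ : 0 ≤ δ) {A : Finset (ℝ × ℝ)}
    (hA : A ⊆ partitionIntervals P) (hAδ : ∀ q ∈ A, ‖x q.2 - x q.1‖ ≤ δ) (hp : 0 < p) :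
    ∑ q ∈ A, ‖R (x q.1) (x q.2)‖ ≤ C * δ ^ (m - p) * W := by
  calc ∑ q ∈ A, ‖R (x q.1) (x q.2)‖
      ≤ ∑ q ∈ A, C * δ ^ (m - p) * ‖x q.2 - x q.1‖ ^ p := by
        refine Finset.sum_le_sum fun q hq => (hR _ _).trans ?_
        rw [mul_assoc]
        refine mul_le_mul_of_nonneg_left ?_ hC
        calc ‖x q.2 - x q.1‖ ^ m = ‖x q.2 - x q.1‖ ^ (m - p) * ‖x q.2 - x q.1‖ ^ p := by
              rw [← Real.rpow_add_of_nonneg (norm_nonneg _) (by linarith) hp.le, sub_add_cancel]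
          _ ≤ δ ^ (m - p) * ‖x q.2 - x q.1‖ ^ p := by
              gcongr
              exact hAδ q hq
    _ = C * δ ^ (m - p) * ∑ q ∈ A, ‖x q.2 - x q.1‖ ^ p := by rw [Finset.mul_sum]
    _ ≤ C * δ ^ (m - p) * W := by
        refine mul_le_mul_of_nonneg_left ?_ (by positivity)
        exact (Finset.sum_le_sum_of_subset_of_nonneg hA fun _ _ _ => by positivity).trans (hW P hP)

/-- Finitely many jump terms are approximated, up to `ε` in total, by terms `R(x_u, x_t)` over
intervals of one partition. All increments are at most `W ^ p⁻¹`, which plays the role of `δ` and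
bounds the finite sums uniformly. -/
theorem summable_norm_leftLim (hT : 0 ≤ T) {p W C m : ℝ} (hp : 0 < p) (hpm : p < m) (hC : 0 ≤ C)
    (hW0 : 0 ≤ W) {R : V → V → U} (hR : ∀ a b, ‖R a b‖ ≤ C * ‖b - a‖ ^ m)
    (hRc : ∀ b, Continuous fun a => R a b) (hx : IsCadlagOn T x)
    (hW : ∀ P, IsPartition T P → ∑ q ∈ partitionIntervals P, ‖x q.2 - x q.1‖ ^ p ≤ W) :
    Summable fun t : Ioc (0 : ℝ) T => ‖R (Function.leftLim x t) (x t)‖ := by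
  classical
  refine summable_of_sum_le (c := C * (W ^ p⁻¹) ^ (m - p) * W) (fun _ => norm_nonneg _) fun s => ?_
  refine le_of_forall_pos_le_add fun ε hε => ?_
  set S : Finset ℝ := s.map (Function.Embedding.subtype _) with hSdef
  have hS : ∀ t ∈ S, t ∈ Ioc 0 T := fun t ht => by
    obtain ⟨r, -, rfl⟩ := Finset.mem_map.1 ht
    exact r.2
  have hε' : 0 < ε / (S.card + 1) := by positivity
  obtain ⟨P, hP, hSP, hφ⟩ := exists_isPartition_forall_left hT hS
    (φ := fun t u => ‖R (Function.leftLim x t) (x t)‖ - ε / (S.card + 1) < ‖R (x u) (x t)‖) (by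
      intro t ht
      have h := (((hRc (x t)).norm.tendsto _).comp (hx.tendsto_leftLim (hS t ht)))
      exact h.eventually (lt_mem_nhds (sub_lt_self _ hε')))
  have hpred : ∀ t ∈ S, ∃ r ∈ P, r < t := fun t ht => ⟨0, hP.1, (hS t ht).1⟩
  have e1 : ∑ t ∈ s, ‖R (Function.leftLim x t) (x t)‖ =
      ∑ q ∈ partitionIntervals P with q.2 ∈ S, ‖R (Function.leftLim x q.2) (x q.2)‖ := by
    rw [sum_partitionIntervals_right hSP hpred fun t => ‖R (Function.leftLim x t) (x t)‖,
      hSdef, Finset.sum_map]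
    rfl
  have e2 : ∑ q ∈ partitionIntervals P with q.2 ∈ S, ε / (S.card + 1) ≤ ε := by
    rw [sum_partitionIntervals_right hSP hpred fun _ => ε / ((S.card : ℝ) + 1),
      Finset.sum_const, nsmul_eq_mul, mul_div_assoc', div_le_iff₀ (by positivity)]
    nlinarith
  have e3 := sum_norm_le_of_norm_sub_le hpm hC hR hW hP (δ := W ^ p⁻¹) (by positivity)
    (Finset.filter_subset (fun q => q.2 ∈ S) (partitionIntervals P)) (fun q hq => by
      obtain ⟨⟨h1, h2⟩, h3, -⟩ := mem_partitionIntervals.1 (Finset.mem_filter.1 hq).1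
      exact norm_sub_le_of_sum_rpow_le hp hW (hP.2.2 _ h1) (hP.2.2 _ h2) h3) hp
  calc ∑ t ∈ s, ‖R (Function.leftLim x t) (x t)‖
      ≤ ∑ q ∈ partitionIntervals P with q.2 ∈ S,
          (‖R (x q.1) (x q.2)‖ + ε / (S.card + 1)) := by
        rw [e1]
        refine Finset.sum_le_sum fun q hq => ?_
        have := hφ P subset_rfl q (Finset.mem_filter.1 hq).1 (Finset.mem_filter.1 hq).2
        linarith
    _ ≤ _ := by
        rw [Finset.sum_add_distrib]
        linarith

/-- For a two-parameter function `R` of order `m > p`, the sums of `R` over the increments of a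
càdlàg path of finite `p`-variation converge to the sum of `R` over its jumps. -/
theorem hasRRSLimit_tsum_leftLim [CompleteSpace U] (hT : 0 ≤ T) {p W C m : ℝ} (hp : 0 < p)
    (hpm : p < m) (hC : 0 ≤ C)
    (hW0 : 0 ≤ W) {R : V → V → U} (hR : ∀ a b, ‖R a b‖ ≤ C * ‖b - a‖ ^ m)
    (hRc : ∀ b, Continuous fun a => R a b) (hx : IsCadlagOn T x)
    (hW : ∀ P, IsPartition T P → ∑ q ∈ partitionIntervals P, ‖x q.2 - x q.1‖ ^ p ≤ W) :
    HasRRSLimit T (fun u v => R (x u) (x v))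
      (∑' t : Ioc (0 : ℝ) T, R (Function.leftLim x t) (x t)) := by
  classical
  intro ε hε
  set g : ℝ → U := fun t => R (Function.leftLim x t) (x t) with hg
  have hsum : Summable fun t : Ioc (0 : ℝ) T => g t :=
    (summable_norm_leftLim hT hp hpm hC hW0 hR hRc hx hW).of_norm
  have hε3 : 0 < ε / 3 := by positivity
  obtain ⟨s, hs⟩ := eventually_atTop.1
    (hsum.hasSum.eventually (Metric.ball_mem_nhds (∑' t : Ioc (0 : ℝ) T, g t) hε3))
  obtain ⟨δ, hδε, hδ⟩ : ∃ δ : ℝ, C * δ ^ (m - p) * W < ε / 3 ∧ 0 < δ := by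
    have h : Tendsto (fun δ : ℝ => C * δ ^ (m - p) * W) (𝓝[>] 0) (𝓝 0) := by
      have h0 := ((Real.continuousAt_rpow_const 0 (m - p) (Or.inr (by linarith))).tendsto.const_mul
        C).mul_const W
      rw [Real.zero_rpow (by linarith), mul_zero, zero_mul] at h0
      exact h0.mono_left nhdsWithin_le_nhds
    exact ((h.eventually (gt_mem_nhds hε3)).and self_mem_nhdsWithin).exists
  obtain ⟨Q₀, hQ₀⟩ := hx.exists_finset_norm_sub_le hδ
  -- `Q₀` controls the oscillation between its points; `s` makes the tail of the jump series small.
  set Q : Finset ℝ := Q₀.filter (· ∈ Ioc 0 T) ∪ s.map (Function.Embedding.subtype _) with hQdef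
  have hQ : ∀ t ∈ Q, t ∈ Ioc 0 T := fun t ht => by
    rcases Finset.mem_union.1 ht with h | h
    · exact (Finset.mem_filter.1 h).2
    · obtain ⟨r, -, rfl⟩ := Finset.mem_map.1 h
      exact r.2
  have hε' : 0 < ε / 3 / (Q.card + 1) := by positivity
  obtain ⟨P₀, hP₀, hQP₀, hφ⟩ := exists_isPartition_forall_left hT hQ
    (φ := fun t u => ‖R (x u) (x t) - g t‖ < ε / 3 / (Q.card + 1)) (by
      intro t ht
      have h := (((hRc (x t)).tendsto _).comp (hx.tendsto_leftLim (hQ t ht)))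
      filter_upwards [h (Metric.ball_mem_nhds _ hε')] with u hu
      rw [← dist_eq_norm]
      exact hu)
  refine ⟨P₀, hP₀, fun P hP hPP => ?_⟩
  have hpred : ∀ t ∈ Q, ∃ r ∈ P, r < t := fun t ht => ⟨0, hP.1, (hQ t ht).1⟩
  have hQP : Q ⊆ P := hQP₀.trans hPP
  have hjump : ‖∑ q ∈ partitionIntervals P with q.2 ∈ Q, (R (x q.1) (x q.2) - g q.2)‖ ≤
      ε / 3 := by
    calc _ ≤ ∑ q ∈ partitionIntervals P with q.2 ∈ Q, ε / 3 / ((Q.card : ℝ) + 1) :=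
          norm_sum_le_of_le _ fun q hq =>
            (hφ P hPP q (Finset.mem_filter.1 hq).1 (Finset.mem_filter.1 hq).2).le
      _ ≤ ε / 3 := by
          rw [sum_partitionIntervals_right hQP hpred fun _ => ε / 3 / ((Q.card : ℝ) + 1),
            Finset.sum_const, nsmul_eq_mul, mul_div_assoc', div_le_iff₀ (by positivity)]
          nlinarith
  have htail : ‖∑ q ∈ partitionIntervals P with q.2 ∈ Q, g q.2 -
      ∑' t : Ioc (0 : ℝ) T, g t‖ < ε / 3 := by
    rw [sum_partitionIntervals_right hQP hpred g, ← Finset.sum_subtype_of_mem g hQ,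
      ← dist_eq_norm]
    refine hs (Q.subtype (· ∈ Ioc 0 T)) fun t ht => ?_
    rw [Finset.mem_subtype, hQdef]
    exact Finset.mem_union_right _ (Finset.mem_map.2 ⟨t, ht, rfl⟩)
  have hsmall : ‖∑ q ∈ partitionIntervals P with q.2 ∉ Q, R (x q.1) (x q.2)‖ < ε / 3 := by
    refine ((norm_sum_le _ _).trans (sum_norm_le_of_norm_sub_le hpm hC hR hW hP hδ.le
      (Finset.filter_subset _ _) (fun q hq => ?_) hp)).trans_lt hδε
    obtain ⟨hq, hqQ⟩ := Finset.mem_filter.1 hq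
    obtain ⟨⟨h1, h2⟩, h3, h4⟩ := mem_partitionIntervals.1 hq
    refine hQ₀ _ (hP.2.2 _ h1) _ (hP.2.2 _ h2) h3.le fun w hw hwI => ?_
    have hwQ : w ∈ Q := Finset.mem_union_left _ (Finset.mem_filter.2
      ⟨hw, (hP.2.2 _ h1).1.trans_lt hwI.1, hwI.2.trans (hP.2.2 _ h2).2⟩)
    -- A point of `Q ⊆ P` in `(u, v]` can only be `v`, which is excluded here.
    rcases h4 w (hQP hwQ) with h | h
    · exact (hwI.1.trans_le h).false
    · exact hqQ (le_antisymm hwI.2 h ▸ hwQ)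
  have hsplit : ∑ q ∈ partitionIntervals P, R (x q.1) (x q.2) - ∑' t : Ioc (0 : ℝ) T, g t =
      ∑ q ∈ partitionIntervals P with q.2 ∈ Q, (R (x q.1) (x q.2) - g q.2) +
      (∑ q ∈ partitionIntervals P with q.2 ∈ Q, g q.2 - ∑' t : Ioc (0 : ℝ) T, g t) +
      ∑ q ∈ partitionIntervals P with q.2 ∉ Q, R (x q.1) (x q.2) := by
    rw [← Finset.sum_filter_add_sum_filter_not (partitionIntervals P) (fun q => q.2 ∈ Q),
      Finset.sum_sub_distrib]
    abel
  rw [hsplit]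
  refine (norm_add₃_le).trans_lt ?_
  linarith

end Paths

/-! ### Taylor remainders and the change of variable formula. -/

section Taylor

variable {V U : Type*} [NormedAddCommGroup V] [NormedSpace ℝ V] [NormedAddCommGroup U]
  [NormedSpace ℝ U]

/-- The remainder at `b` of the Taylor expansion of order `n` of `F` around `a`. -/
noncomputable def taylorRemainder (n : ℕ) (F : V → U) (a b : V) : U :=
  F b - F a - ∑ k ∈ Finset.Icc 1 n, (1 / (k.factorial : ℝ)) •
    iteratedFDeriv ℝ k F a (fun _ => b - a)

/-- Continuity in the expansion point is what allows `x_u` to be replaced by `x_{t-}` in the limit.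
-/
theorem continuous_taylorRemainder {n : ℕ} {F : V → U} (hF : ContDiff ℝ n F) (b : V) :
    Continuous fun a => taylorRemainder n F a b := by
  refine (continuous_const.sub hF.continuous).sub (continuous_finsetSum _ fun k hk => ?_)
  have hk' : Continuous (iteratedFDeriv ℝ k F) :=
    hF.continuous_iteratedFDeriv (by exact_mod_cast (Finset.mem_Icc.1 hk).2)
  refine Continuous.const_smul ?_ _
  exact continuous_eval.comp (hk'.prodMk (continuous_pi fun _ => continuous_const.sub continuous_id))

/-- From the integral form of the remainder, with `(1 - t) ^ n` and `1 / n!` both bounded by `1`. -/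
theorem norm_taylorRemainder_le [CompleteSpace U] {n : ℕ} {F : V → U} (hF : ContDiff ℝ (n + 1) F)
    {C : ℝ} (hC : ∀ v, ‖iteratedFDeriv ℝ (n + 1) F v‖ ≤ C) (a b : V) :
    ‖taylorRemainder n F a b‖ ≤ C * ‖b - a‖ ^ (n + 1) := by
  have hC0 : 0 ≤ C := (norm_nonneg _).trans (hC a)
  have h := map_add_eq_sum_add_integral_iteratedFDeriv (f := F) (x := a) (y := b - a) (n := n)
    fun t _ => hF.contDiffAt
  have hrem : taylorRemainder n F a b = ((n.factorial : ℝ))⁻¹ •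
      ∫ t in (0 : ℝ)..1, (1 - t) ^ n • iteratedFDeriv ℝ (n + 1) F (a + t • (b - a))
        (fun _ => b - a) := by
    rw [add_sub_cancel, Finset.sum_range_eq_add_Ico _ (Nat.succ_pos n), Nat.succ_eq_add_one] at h
    rw [taylorRemainder, h, ← Finset.Ico_add_one_right_eq_Icc]
    simp only [Nat.factorial_zero, Nat.cast_one, inv_one, one_smul, iteratedFDeriv_zero_apply,
      one_div]
    abel
  rw [hrem, norm_smul, Real.norm_of_nonneg (by positivity)]
  have hint : ‖∫ t in (0 : ℝ)..1, (1 - t) ^ n • iteratedFDeriv ℝ (n + 1) F (a + t • (b - a))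
      (fun _ => b - a)‖ ≤ C * ‖b - a‖ ^ (n + 1) * |1 - 0| := by
    refine intervalIntegral.norm_integral_le_of_norm_le_const fun t ht => ?_
    rw [uIoc_of_le zero_le_one] at ht
    have h1 : ‖(1 - t) ^ n‖ ≤ 1 := by
      rw [norm_pow, Real.norm_of_nonneg (by linarith [ht.2])]
      exact pow_le_one₀ (by linarith [ht.2]) (by linarith [ht.1])
    have h2 := ((iteratedFDeriv ℝ (n + 1) F (a + t • (b - a))).le_opNorm (fun _ => b - a))
    rw [Finset.prod_const, Finset.card_univ, Fintype.card_fin] at h2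
    rw [norm_smul]
    calc _ ≤ 1 * (C * ‖b - a‖ ^ (n + 1)) := by
          refine mul_le_mul h1 (h2.trans ?_) (norm_nonneg _) zero_le_one
          exact mul_le_mul_of_nonneg_right (hC _) (by positivity)
      _ = _ := one_mul _
  rw [sub_zero, abs_one, mul_one] at hint
  refine (mul_le_mul_of_nonneg_left hint (by positivity)).trans ?_
  refine mul_le_of_le_one_left (by positivity) (inv_le_one_of_one_le₀ ?_)
  exact_mod_cast Nat.one_le_iff_ne_zero.2 n.factorial_ne_zero

theorem sum_gradientPath_reducedLift (n : ℕ) (F : V → U) (x : ℝ → V) (u v : ℝ) :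
    ∑ k ∈ Finset.range n, gradientPath F x k u (reducedLift x (k + 1) u v) =
      F (x v) - F (x u) - taylorRemainder n F (x u) (x v) := by
  rw [taylorRemainder, sub_sub_cancel, ← Finset.Ico_add_one_right_eq_Icc,
    Finset.sum_Ico_eq_sum_range, Nat.add_sub_cancel]
  refine Finset.sum_congr rfl fun k _ => ?_
  rw [gradientPath, reducedLift, map_smul, PiTensorProduct.lift.tprod, add_comm 1 k]
  rfl

theorem leftJumpCorrection_eq_taylorRemainder (n : ℕ) (F : V → U) (x : ℝ → V) (t : ℝ) :
    leftJumpCorrection n F x t = taylorRemainder n F (Function.leftLim x t) (x t) :=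
  rfl

/-- The pathwise change of variable formula for a càdlàg path of finite `p`-variation. -/
theorem exists_hasReducedRoughIntegral [CompleteSpace U] {T p : ℝ} (hT : 0 ≤ T) (hp : 1 ≤ p) {n : ℕ}
    (hpn : p < n + 1) {x : ℝ → V} (hx : IsCadlagOn T x) (hxp : pVariation p T x < ∞) {F : V → U}
    (hF : IsCb (n + 1) F) :
    (Summable fun t : Ioc (0 : ℝ) T => ‖leftJumpCorrection n F x t‖) ∧
      ∃ I : U, HasReducedRoughIntegral n T (gradientPath F x) (reducedLift x) I ∧
        F (x T) - F (x 0) = I + ∑' t : Ioc (0 : ℝ) T, leftJumpCorrection n F x t := by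
  have hp0 : 0 < p := by linarith
  obtain ⟨W, hW0, hW⟩ := exists_sum_rpow_le_of_pVariation_lt_top hp hxp
  obtain ⟨C, hC⟩ := hF.2 _ le_rfl
  have hC0 : 0 ≤ C := (norm_nonneg _).trans (hC 0)
  have hR : ∀ a b, ‖taylorRemainder n F a b‖ ≤ C * ‖b - a‖ ^ ((n : ℝ) + 1) := by
    intro a b
    have h := norm_taylorRemainder_le (by simpa using hF.1) hC a b
    rwa [← Real.rpow_natCast, Nat.cast_add_one] at h
  have hRc := continuous_taylorRemainder (n := n) (F := F)
    (hF.1.of_le (Nat.cast_le.2 n.le_succ))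
  simp only [leftJumpCorrection_eq_taylorRemainder]
  -- The integral is taken to be what the formula forces; the content is that the Riemann sums
  -- converge to it.
  refine ⟨summable_norm_leftLim hT hp0 hpn hC0 hW0 hR hRc hx hW,
    F (x T) - F (x 0) - ∑' t : Ioc (0 : ℝ) T, taylorRemainder n F (Function.leftLim x t) (x t), ?_,
    by abel⟩
  intro ε hε
  obtain ⟨P₀, hP₀, h⟩ := hasRRSLimit_tsum_leftLim hT hp0 hpn hC0 hW0 hR hRc hx hW ε hε
  refine ⟨P₀, hP₀, fun P hP hPP => ?_⟩
  have h' := h P hP hPP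
  have hsum : ∑ q ∈ partitionIntervals P, ∑ k ∈ Finset.range n,
      gradientPath F x k q.1 (reducedLift x (k + 1) q.1 q.2) =
      F (x T) - F (x 0) - ∑ q ∈ partitionIntervals P, taylorRemainder n F (x q.1) (x q.2) := by
    rw [← hP.sum_sub fun t => F (x t), ← Finset.sum_sub_distrib]
    exact Finset.sum_congr rfl fun q _ => sum_gradientPath_reducedLift _ F x q.1 q.2
  rw [hsum, sub_sub_sub_cancel_left, norm_sub_rev]
  exact h'

end Taylor

theorem mainTheorem5 {Ω : Type*} [MeasurableSpace Ω] (ℙ : Measure Ω) [IsProbabilityMeasure ℙ]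
    {V : Type*} [NormedAddCommGroup V] [NormedSpace ℝ V] [CompleteSpace V]
    [MeasurableSpace V] [BorelSpace V]
    {U : Type*} [NormedAddCommGroup U] [NormedSpace ℝ U] [CompleteSpace U]
    (T : ℝ) (hT : 0 ≤ T) (p : ℝ) (hp : 1 ≤ p)
    (X : ℝ → Ω → V) (hXmeas : ∀ t ∈ Icc (0 : ℝ) T, Measurable (X t))
    (hXcadlag : ∀ᵐ ω ∂ℙ, IsCadlagOn T (fun t => X t ω))
    (hXvar : ∀ᵐ ω ∂ℙ, pVariation p T (fun t => X t ω) < ∞)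
    (F : V → U) (hF : IsCb (⌊p⌋₊ + 1) F) :
    ∀ᵐ ω ∂ℙ,
      (Summable fun t : Ioc (0 : ℝ) T => ‖leftJumpCorrection ⌊p⌋₊ F (fun s => X s ω) t‖) ∧
      ∃ I : U,
        HasReducedRoughIntegral ⌊p⌋₊ T (gradientPath F (fun t => X t ω))
          (reducedLift (fun t => X t ω)) I ∧
        F (X T ω) - F (X 0 ω) =
          I + ∑' t : Ioc (0 : ℝ) T, leftJumpCorrection ⌊p⌋₊ F (fun s => X s ω) t := by
  filter_upwards [hXcadlag, hXvar] with ω hx hv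
  exact exists_hasReducedRoughIntegral hT hp (Nat.lt_floor_add_one p) hx hv hF
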